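/- Proposition 6.2 (Rectifiability in books). Let $k\ge 1$ and let $X=\big(\{1,\dots,k\}\times\mathbb{R}\times[0,\infty)\big)/\!\sim$ be the open book with $k$ sheets, where $(i,a,b)\sim(j,a',b')$ if the two triples are equal or if $a=a'$ and $b=b'=0$. Equip $X$ with the distance $d$ given by $d\big((i,a,b),(j,a',b')\big)=\sqrt{(a-a')^2+(b-b')^2}$ if $i=j$, and by $\sqrt{(a-a')^2+(b+b')^2}$ if $i\ne j$ (the length metric of the glued space; equivalently, $X$ is the $\ell^2$-product of $\mathbb{R}$ and the $k$-spider with infinite legs). Let $\ell\in(0,\infty]$ and let $\xi:[0,\ell)\to X$ be a map, not necessarily continuous, with bounded image $\Xi=\xi([0,\ell))$, that is self-contracted, i.e. $d(\xi(t_2),\xi(t_3))\le d(\xi(t_1),\xi(t_3))$ whenever $0\le t_1\le t_2\le t_3<\ell$. Let $\mathsf{L}(\xi)=\sup\sum_{i=1}^{n} d(\xi(t_{i-1}),\xi(t_i))$, the supremum over all $n$ and all $0\le t_0\le t_1\le\dots\le t_n<\ell$, be the length of $\xi$, and let $\Omega=\{x\in X : d(x,y)<1 \text{ for some } y\in\Xi\}$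 be the $1$-neighborhood of $\Xi$. Then, with the universal constant $C=54\sqrt{2}\,\pi$, $$\mathsf{L}(\xi)\ \le\ C\,k\,\mathcal{H}^2(\Omega)\,\operatorname{diam}(\Xi)\ <\ \infty ,$$ where $\mathcal{H}^2$ is the $2$-dimensional Hausdorff measure of $(X,d)$, normalized so that it is the area on the Euclidean plane. -/

import Mathlib

open Set MeasureTheory
open scoped NNReal ENNReal

/-- The points of `k` disjoint closed half-planes `ℝ × [0, ∞)` before gluing: `(i, a, b)` is the
point with coordinates `(a, b)` in the `i`-th half-plane. -/
abbrev PrePoint (k : ℕ) : Type := Fin k × ℝ × ℝ≥0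

/-- The gluing relation: `(i, a, b) ∼ (j, a', b')` if the points are equal, or if `a = a'` and
`b = b' = 0`. -/
def bookRel (k : ℕ) (p q : PrePoint k) : Prop :=
  p = q ∨ (p.2.1 = q.2.1 ∧ p.2.2 = 0 ∧ q.2.2 = 0)

/-- The gluing relation is an equivalence relation. -/
def bookSetoid (k : ℕ) : Setoid (PrePoint k) where
  r := bookRel k
  iseqv := by
    refine ⟨fun p => Or.inl rfl, ?_, ?_⟩
    · rintro p q (h | ⟨h1, h2, h3⟩)
      · exact Or.inl h.symm
      · exact Or.inr ⟨h1.symm, h3, h2⟩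
    · rintro p q r (h | ⟨h1, h2, h3⟩) (h' | ⟨h1', h2', h3'⟩)
      · exact Or.inl (h.trans h')
      · subst h; exact Or.inr ⟨h1', h2', h3'⟩
      · subst h'; exact Or.inr ⟨h1, h2, h3⟩
      · exact Or.inr ⟨h1.trans h1', h2, h3'⟩

/-- The open book with `k` sheets: `k` closed half-planes glued along their boundary lines. -/
def Book (k : ℕ) : Type := Quotient (bookSetoid k)

/-- The signed length of the second leg: the difference of the heights over the binding for points
in the same sheet, and the sum of the heights for points in different sheets. Its absolute value
is the distance in the `k`-spider. -/
noncomputable def spiderGap {k : ℕ} (p q : PrePoint k) : ℝ :=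
  if p.1 = q.1 then (p.2.2 : ℝ) - q.2.2 else (p.2.2 : ℝ) + q.2.2

/-- The distance of the book on representatives. In one sheet it is the Euclidean distance. For
points in different sheets it is the Euclidean distance after unfolding the two sheets to a plane,
which is the shortest length of a path through the binding; equivalently it is the `ℓ²` product
distance of `ℝ` and the `k`-spider. -/
noncomputable def preDist {k : ℕ} (p q : PrePoint k) : ℝ :=
  √((p.2.1 - q.2.1) ^ 2 + spiderGap p q ^ 2)

theorem spiderGap_self {k : ℕ} (p : PrePoint k) : spiderGap p p = 0 := by
  simp [spiderGap]

theorem spiderGap_sq_comm {k : ℕ} (p q : PrePoint k) :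
    spiderGap p q ^ 2 = spiderGap q p ^ 2 := by
  unfold spiderGap
  by_cases h : p.1 = q.1
  · rw [if_pos h, if_pos h.symm]; ring
  · rw [if_neg h, if_neg (Ne.symm h)]; ring

theorem preDist_comm {k : ℕ} (p q : PrePoint k) : preDist p q = preDist q p := by
  unfold preDist
  rw [spiderGap_sq_comm p q]
  congr 1
  ring

theorem abs_spiderGap_triangle {k : ℕ} (p q r : PrePoint k) :
    |spiderGap p r| ≤ |spiderGap p q| + |spiderGap q r| := by
  have hp := p.2.2.coe_nonneg
  have hq := q.2.2.coe_nonneg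
  have hr := r.2.2.coe_nonneg
  unfold spiderGap
  have e1 := le_abs_self ((p.2.2 : ℝ) - q.2.2)
  have e2 := neg_le_abs ((p.2.2 : ℝ) - q.2.2)
  have e3 := le_abs_self ((q.2.2 : ℝ) - r.2.2)
  have e4 := neg_le_abs ((q.2.2 : ℝ) - r.2.2)
  have e5 := le_abs_self ((p.2.2 : ℝ) + q.2.2)
  have e6 := le_abs_self ((q.2.2 : ℝ) + r.2.2)
  split_ifs with h1 h2 h3 h4 h5 h6 h7
  all_goals first
    | (rw [abs_le]; constructor <;> linarith)
    | (exfalso; simp_all)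

theorem preDist_triangle {k : ℕ} (p q r : PrePoint k) :
    preDist p r ≤ preDist p q + preDist q r := by
  have h1 := abs_spiderGap_triangle p q r
  have h2 : |p.2.1 - r.2.1| ≤ |p.2.1 - q.2.1| + |q.2.1 - r.2.1| := abs_sub_le _ _ _
  have key := norm_add_le (!₂[|p.2.1 - q.2.1|, |spiderGap p q|] : EuclideanSpace ℝ (Fin 2))
    (!₂[|q.2.1 - r.2.1|, |spiderGap q r|] : EuclideanSpace ℝ (Fin 2))
  simp only [EuclideanSpace.norm_eq, Fin.sum_univ_two, Real.norm_eq_abs, sq_abs, PiLp.add_apply,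
    Matrix.cons_val_zero, Matrix.cons_val_one] at key
  refine le_trans (Real.sqrt_le_sqrt (add_le_add ?_ ?_)) key
  · rw [← sq_abs (p.2.1 - r.2.1)]
    exact pow_le_pow_left₀ (abs_nonneg _) h2 2
  · rw [← sq_abs (spiderGap p r)]
    exact pow_le_pow_left₀ (abs_nonneg _) h1 2

theorem preDist_eq_zero_iff {k : ℕ} (p q : PrePoint k) : preDist p q = 0 ↔ bookRel k p q := by
  have hp := p.2.2.coe_nonneg
  have hq := q.2.2.coe_nonneg
  unfold preDist
  rw [Real.sqrt_eq_zero (by positivity)]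
  constructor
  · intro h
    have h1 : p.2.1 = q.2.1 := by nlinarith [sq_nonneg (p.2.1 - q.2.1), sq_nonneg (spiderGap p q)]
    have h2 : spiderGap p q = 0 := by
      nlinarith [sq_nonneg (p.2.1 - q.2.1), sq_nonneg (spiderGap p q)]
    unfold spiderGap at h2
    by_cases h3 : p.1 = q.1
    · rw [if_pos h3] at h2
      exact Or.inl (Prod.ext h3 (Prod.ext h1 (NNReal.coe_injective (by linarith))))
    · rw [if_neg h3] at h2
      exact Or.inr ⟨h1, NNReal.coe_injective (by push_cast; linarith),
        NNReal.coe_injective (by push_cast; linarith)⟩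
  · rintro (h | ⟨h1, h2, h3⟩)
    · subst h; simp [spiderGap_self]
    · simp [spiderGap, h1, h2, h3]

theorem preDist_congr {k : ℕ} (p q p' q' : PrePoint k) (hp : bookRel k p p')
    (hq : bookRel k q q') : preDist p q = preDist p' q' := by
  have h1 := (preDist_eq_zero_iff p p').2 hp
  have h2 := (preDist_eq_zero_iff q q').2 hq
  have h3 := preDist_triangle p p' q
  have h4 := preDist_triangle p' q' q
  have h5 := preDist_triangle p' p q'
  have h6 := preDist_triangle p q q'
  rw [preDist_comm q' q] at h4
  rw [preDist_comm p' p] at h5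
  linarith

noncomputable instance (k : ℕ) : MetricSpace (Book k) where
  dist x y := Quotient.lift₂ preDist (fun p q p' q' hp hq => preDist_congr p q p' q' hp hq) x y
  dist_self x := Quotient.inductionOn x fun p => (preDist_eq_zero_iff p p).2 (Or.inl rfl)
  dist_comm x y := Quotient.inductionOn₂ x y fun p q => preDist_comm p q
  dist_triangle x y z := Quotient.inductionOn₃ x y z fun p q r => preDist_triangle p q r
  eq_of_dist_eq_zero {x y} := Quotient.inductionOn₂ x y fun p q h =>
    Quotient.sound ((preDist_eq_zero_iff p q).1 h)

noncomputable instance (k : ℕ) : MeasurableSpace (Book k) := borel (Book k)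

instance (k : ℕ) : BorelSpace (Book k) := ⟨rfl⟩

/-- The two-dimensional Hausdorff measure `ℋ²` with its usual normalization, for which it is the
area on the Euclidean plane. The measure `μH[2]` is built from the sums of the `(diam U) ^ 2`, hence
the factor `π / 4`, the area of a disc of diameter one. -/
noncomputable def hausdorffTwo (X : Type*) [MetricSpace X] [MeasurableSpace X] [BorelSpace X] :
    Measure X :=
  ENNReal.ofReal (Real.pi / 4) • Measure.hausdorffMeasure 2

/-- The half-open interval `[0, ℓ)` for `ℓ ∈ [0, ∞]`. -/
abbrev HalfOpen (ℓ : ℝ≥0∞) : Type := {t : ℝ≥0 // (t : ℝ≥0∞) < ℓ}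

/-- Self-contracted curves; no continuity is required. -/
def SelfContracted {X : Type*} [MetricSpace X] {ℓ : ℝ≥0∞} (ξ : HalfOpen ℓ → X) : Prop :=
  ∀ t₁ t₂ t₃ : HalfOpen ℓ, t₁ ≤ t₂ → t₂ ≤ t₃ → dist (ξ t₂) (ξ t₃) ≤ dist (ξ t₁) (ξ t₃)

/-- The length of a (possibly discontinuous) curve: the supremum over all partitions of the sum of
the distances of consecutive points. -/
noncomputable def curveLength {X : Type*} [MetricSpace X] {ℓ : ℝ≥0∞} (ξ : HalfOpen ℓ → X) :
    ℝ≥0∞ :=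
  eVariationOn ξ univ

/-! Seen from a point of a planar self-contracted curve, the later points lie at pairwise non-obtuse
angles, so any finitely many of them lie in a quadrant and recede along one of eight fixed
directions. A step of length `δ` therefore lowers the support function of the tail in some direction
by at least `δ / 5`, and the sum of the eight support functions is a bounded antitone potential
(`exists_potential_of_planar`).

Any two sheets of the book unfold isometrically onto a plane, and self-contractedness passes to the
times spent in them. The resulting potential is antitone in all times, also those spent elsewhere.
Each step joins points of some pair of visited sheets, so the sum over all pairs controls every step
and telescopes: with `m` visited sheets the length is at most `120 m² D`. One factor `m` is at most
`k`; the other is paid for by the neighborhood, which has area bounded below in each visited sheet.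
-/

/-! ### Plane vectors at non-obtuse angles -/

/-- Given finitely many plane vectors with pairwise nonnegative inner products, not all zero, one of
them is extremal: all the others lie on its left. -/
theorem exists_extremal_vector {ι : Type*} (T : Finset ι) (u w : ι → ℝ)
    (hT : ∀ i ∈ T, ∀ j ∈ T, 0 ≤ u i * u j + w i * w j)
    (hne : ∃ i ∈ T, 0 < u i ^ 2 + w i ^ 2) :
    ∃ i ∈ T, 0 < u i ^ 2 + w i ^ 2 ∧ ∀ j ∈ T, 0 ≤ u i * w j - w i * u j := by
  classical
  induction T using Finset.induction_on with
  | empty => simp at hne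
  | insert a T ha ih =>
    have hT' : ∀ i ∈ T, ∀ j ∈ T, 0 ≤ u i * u j + w i * w j := fun i hi j hj =>
      hT i (Finset.mem_insert_of_mem hi) j (Finset.mem_insert_of_mem hj)
    by_cases hn : ∃ i ∈ T, 0 < u i ^ 2 + w i ^ 2
    · obtain ⟨v, hv, hv0, hvT⟩ := ih hT' hn
      have hvm := Finset.mem_insert_of_mem (a := v) (b := a) hv
      by_cases hd : 0 ≤ u v * w a - w v * u a
      · refine ⟨v, hvm, hv0, fun j hj => ?_⟩
        rcases Finset.mem_insert.1 hj with rfl | hj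
        · exact hd
        · exact hvT j hj
      · push Not at hd
        refine ⟨a, Finset.mem_insert_self _ _, ?_, fun j hj => ?_⟩
        · by_contra h0
          have h1 : u a = 0 := by nlinarith [sq_nonneg (u a), sq_nonneg (w a)]
          have h2 : w a = 0 := by nlinarith [sq_nonneg (u a), sq_nonneg (w a)]
          simp [h1, h2] at hd
        · rcases Finset.mem_insert.1 hj with rfl | hj'
          · linarith [mul_comm (u j) (w j)]
          -- Sine addition: the angle from `a` to `j` is that from `a` to `v` plus that from `v` to
          -- `j`.
          · have e : (u v ^ 2 + w v ^ 2) * (u a * w j - w a * u j) =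
                (u a * w v - w a * u v) * (u v * u j + w v * w j) +
                (u a * u v + w a * w v) * (u v * w j - w v * u j) := by ring
            have p1 := mul_nonneg (by linarith : 0 ≤ u a * w v - w a * u v) (hT' v hv j hj')
            have p2 := mul_nonneg (hT a (Finset.mem_insert_self _ _) v hvm) (hvT j hj')
            exact nonneg_of_mul_nonneg_right (by rw [e]; linarith) hv0
    · push Not at hn
      have hz : ∀ j ∈ T, u j = 0 ∧ w j = 0 := fun j hj =>
        ⟨by nlinarith [hn j hj, sq_nonneg (u j), sq_nonneg (w j)],
          by nlinarith [hn j hj, sq_nonneg (u j), sq_nonneg (w j)]⟩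
      obtain ⟨i, hi, hi0⟩ := hne
      rcases Finset.mem_insert.1 hi with rfl | hi
      · refine ⟨i, Finset.mem_insert_self _ _, hi0, fun j hj => ?_⟩
        rcases Finset.mem_insert.1 hj with rfl | hj
        · linarith [mul_comm (u j) (w j)]
        · simp [hz j hj]
      · exact absurd hi0 (not_lt.2 (hn i hi))

/-- The eight compass directions of the plane. -/
def compass : Fin 8 → ℝ × ℝ :=
  ![(1, 0), (-1, 0), (0, 1), (0, -1), (1, 1), (-1, -1), (1, -1), (-1, 1)]

/-- `3 / 2` exceeds `√2`, the norm of the diagonal directions. -/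
theorem abs_inner_compass_le (c : Fin 8) (a b : ℝ) :
    |a * (compass c).1 + b * (compass c).2| ≤ 3 / 2 * √(a ^ 2 + b ^ 2) := by
  have h : |a * (compass c).1 + b * (compass c).2| ≤ √((3 / 2) ^ 2 * (a ^ 2 + b ^ 2)) := by
    apply Real.abs_le_sqrt
    fin_cases c <;> simp [compass] <;> nlinarith [sq_nonneg (a + b), sq_nonneg (a - b),
      sq_nonneg a, sq_nonneg b]
  rwa [Real.sqrt_mul (by positivity), Real.sqrt_sq (by norm_num)] at h

/-- Every quadrant contains a compass direction well inside. -/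
theorem exists_compass_in_quadrant (p q r : ℝ) (hr : 0 < r) (h : p ^ 2 + q ^ 2 = r ^ 2) :
    ∃ c : Fin 8, p * (compass c).1 + q * (compass c).2 ≤ -(2 / 5 * r) ∧
      p * (compass c).2 - q * (compass c).1 ≤ -(2 / 5 * r) := by
  -- If one coordinate is below `2 / 5 * r` in size, the other is at least `4 / 5 * r`, and a
  -- diagonal direction still gains `4 / 5 - 2 / 5`.
  have key : ∀ x y : ℝ, 0 ≤ x → x ^ 2 + y ^ 2 = r ^ 2 → y < 2 / 5 * r → -(2 / 5 * r) < y →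
      4 / 5 * r ≤ x := by
    intro x y hx hxy h1 h2
    by_contra hc
    push Not at hc
    nlinarith [mul_pos (sub_pos.2 h1) (by linarith : 0 < y + 2 / 5 * r), mul_nonneg hx hr.le]
  rcases le_or_gt (2 / 5 * r) q with hq | hq
  · rcases le_or_gt (2 / 5 * r) p with hp | hp
    · exact ⟨3, by simp [compass]; constructor <;> linarith⟩
    · rcases le_or_gt p (-(2 / 5 * r)) with hp' | hp'
      · exact ⟨0, by simp [compass]; constructor <;> linarith⟩
      · have := key q p (by linarith) (by linarith) hp hp'
        exact ⟨6, by simp [compass]; constructor <;> linarith⟩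
  · rcases le_or_gt q (-(2 / 5 * r)) with hq' | hq'
    · rcases le_or_gt (2 / 5 * r) p with hp | hp
      · exact ⟨1, by simp [compass]; constructor <;> linarith⟩
      · rcases le_or_gt p (-(2 / 5 * r)) with hp' | hp'
        · exact ⟨2, by simp [compass]; constructor <;> linarith⟩
        · have := key (-q) p (by linarith) (by linarith [neg_sq q]) hp hp'
          exact ⟨7, by simp [compass]; constructor <;> linarith⟩
    · rcases le_total 0 p with hp | hp
      · have := key p q hp h hq hq'
        exact ⟨5, by simp [compass]; constructor <;> linarith⟩
      · have := key (-p) q (by linarith) (by linarith [neg_sq p]) hq hq'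
        exact ⟨4, by simp [compass]; constructor <;> linarith⟩

/-- Finitely many plane vectors with pairwise nonnegative inner products point uniformly away from
one of the compass directions. -/
theorem exists_compass_opposite {ι : Type*} (T : Finset ι) (u w : ι → ℝ)
    (hT : ∀ i ∈ T, ∀ j ∈ T, 0 ≤ u i * u j + w i * w j) :
    ∃ c : Fin 8, ∀ i ∈ T, u i * (compass c).1 + w i * (compass c).2 ≤
      -(2 / 5 * √(u i ^ 2 + w i ^ 2)) := by
  by_cases hn : ∃ i ∈ T, 0 < u i ^ 2 + w i ^ 2
  · obtain ⟨v, hv, hv0, hvT⟩ := exists_extremal_vector T u w hT hn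
    set r := √(u v ^ 2 + w v ^ 2) with hr
    have hr0 : 0 < r := Real.sqrt_pos.2 hv0
    have hr2 : u v ^ 2 + w v ^ 2 = r ^ 2 := (Real.sq_sqrt hv0.le).symm
    obtain ⟨c, h1, h2⟩ := exists_compass_in_quadrant (u v) (w v) r hr0 hr2
    refine ⟨c, fun i hi => ?_⟩
    set ρ := √(u i ^ 2 + w i ^ 2)
    have hρ2 : ρ ^ 2 = u i ^ 2 + w i ^ 2 := Real.sq_sqrt (by positivity)
    have hρ0 : 0 ≤ ρ := Real.sqrt_nonneg _
    have a0 : 0 ≤ u v * u i + w v * w i := hT v hv i hi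
    have b0 : 0 ≤ u v * w i - w v * u i := hvT i hi
    -- The squares of the dot and cross products sum to `(r * ρ) ^ 2`, and both products are
    -- nonnegative.
    have hab : r * ρ ≤ (u v * u i + w v * w i) + (u v * w i - w v * u i) := by
      refine (sq_le_sq₀ (by positivity) (add_nonneg a0 b0)).1 ?_
      rw [mul_pow, hρ2, ← hr2]
      nlinarith [mul_nonneg a0 b0]
    have e : r ^ 2 * (u i * (compass c).1 + w i * (compass c).2) =
        (u v * (compass c).1 + w v * (compass c).2) * (u v * u i + w v * w i) +
        (u v * (compass c).2 - w v * (compass c).1) * (u v * w i - w v * u i) := by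
      rw [← hr2]; ring
    have m1 := mul_le_mul_of_nonneg_right h1 a0
    have m2 := mul_le_mul_of_nonneg_right h2 b0
    have m3 := mul_le_mul_of_nonneg_left hab (by positivity : 0 ≤ 2 / 5 * r)
    refine le_of_mul_le_mul_left ?_ (pow_pos hr0 2)
    rw [e]
    nlinarith
  · push Not at hn
    refine ⟨0, fun i hi => ?_⟩
    have h1 : u i = 0 := by nlinarith [hn i hi, sq_nonneg (u i), sq_nonneg (w i)]
    have h2 : w i = 0 := by nlinarith [hn i hi, sq_nonneg (u i), sq_nonneg (w i)]
    simp [h1, h2]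

/-! ### The potential of a planar curve -/

/-- A planar self-contracted curve has a bounded potential: its steps are controlled by the decrease
of an antitone function, a sum of support functions of the tails of the curve. -/
theorem exists_potential_of_planar {α : Type*} [LinearOrder α] (S : Set α) (x y : α → ℝ) (D : ℝ)
    (hsc : ∀ s ∈ S, ∀ t ∈ S, ∀ j ∈ S, s ≤ t → t ≤ j →
      (x t - x j) ^ 2 + (y t - y j) ^ 2 ≤ (x s - x j) ^ 2 + (y s - y j) ^ 2)
    (hD0 : 0 ≤ D)
    (hD : ∀ s ∈ S, ∀ t ∈ S, √((x s - x t) ^ 2 + (y s - y t) ^ 2) ≤ D) :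
    ∃ G : α → ℝ, Antitone G ∧ (∀ t, 0 ≤ G t) ∧ (∀ t, G t ≤ 24 * D) ∧
      ∀ s ∈ S, ∀ t ∈ S, s ≤ t → √((x s - x t) ^ 2 + (y s - y t) ^ 2) ≤ 5 * (G s - G t) := by
  classical
  rcases S.eq_empty_or_nonempty with rfl | ⟨o, ho⟩
  · exact ⟨fun _ => 0, antitone_const, fun _ => le_rfl, fun _ => by positivity, by simp⟩
  -- The shift makes `v` nonnegative on `S`, so that `h` stays antitone where the tail is empty and
  -- `sSup ∅ = 0`.
  set v : Fin 8 → α → ℝ := fun c s =>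
    (x s - x o) * (compass c).1 + (y s - y o) * (compass c).2 + 3 / 2 * D with hv
  have hvb : ∀ c, ∀ s ∈ S, 0 ≤ v c s ∧ v c s ≤ 3 * D := by
    intro c s hs
    have h := abs_le.1 (abs_inner_compass_le c (x s - x o) (y s - y o))
    have h' := hD s hs o ho
    simp only [hv]
    constructor <;> linarith [h.1, h.2]
  set h : Fin 8 → α → ℝ := fun c t => sSup (v c '' {s | s ∈ S ∧ t ≤ s}) with hh
  have hbdd : ∀ c t, BddAbove (v c '' {s | s ∈ S ∧ t ≤ s}) := by
    rintro c t
    refine ⟨3 * D, ?_⟩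
    rintro _ ⟨s, hs, rfl⟩
    exact (hvb c s hs.1).2
  have h0 : ∀ c t, 0 ≤ h c t := by
    intro c t
    apply Real.sSup_nonneg
    rintro _ ⟨s, hs, rfl⟩
    exact (hvb c s hs.1).1
  have h3 : ∀ c t, h c t ≤ 3 * D := by
    intro c t
    refine Real.sSup_le ?_ (by positivity)
    rintro _ ⟨s, hs, rfl⟩
    exact (hvb c s hs.1).2
  have hanti : ∀ c, Antitone (h c) := by
    intro c s t hst
    refine Real.sSup_le ?_ (h0 c s)
    rintro _ ⟨j, hj, rfl⟩
    exact le_csSup (hbdd c s) ⟨j, ⟨hj.1, hst.trans hj.2⟩, rfl⟩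
  refine ⟨fun t => ∑ c, h c t, fun s t hst => Finset.sum_le_sum fun c _ => hanti c hst,
    fun t => Finset.sum_nonneg fun c _ => h0 c t, fun t => ?_, fun s hs t ht hst => ?_⟩
  · refine (Finset.sum_le_sum fun c _ => h3 c t).trans ?_
    simp
    linarith
  set δ := √((x s - x t) ^ 2 + (y s - y t) ^ 2) with hδ
  -- Otherwise each direction has a bad later time, and these eight points contradict
  -- `exists_compass_opposite`.
  obtain ⟨c, hc⟩ : ∃ c, ∀ j ∈ S, t ≤ j → v c j ≤ v c s - δ / 5 := by
    by_contra hcon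
    push Not at hcon
    choose j hjS htj hj using hcon
    obtain ⟨c, hc⟩ := exists_compass_opposite Finset.univ (fun c => x (j c) - x s)
      (fun c => y (j c) - y s) (by
        have aux : ∀ c c', j c ≤ j c' →
            0 ≤ (x (j c) - x s) * (x (j c') - x s) + (y (j c) - y s) * (y (j c') - y s) := by
          intro c c' hcc
          have := hsc s hs (j c) (hjS c) (j c') (hjS c') (hst.trans (htj c)) hcc
          nlinarith [sq_nonneg (x (j c) - x s), sq_nonneg (y (j c) - y s)]
        intro c _ c' _
        rcases le_total (j c) (j c') with hcc | hcc
        · exact aux c c' hcc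
        · have := aux c' c hcc
          linarith)
    have h1 := hc c (Finset.mem_univ c)
    have h2 := hsc s hs t ht (j c) (hjS c) hst (htj c)
    -- Triangle inequality through `j c`, with `h2`; it turns `2 / 5` into `1 / 5`.
    have h4 : δ ≤ 2 * √((x (j c) - x s) ^ 2 + (y (j c) - y s) ^ 2) := by
      rw [show (2 : ℝ) = √(2 ^ 2) by rw [Real.sqrt_sq (by norm_num)],
        ← Real.sqrt_mul (by norm_num)]
      apply Real.sqrt_le_sqrt
      nlinarith [sq_nonneg (x s - x t - 2 * (x s - x (j c))),
        sq_nonneg (y s - y t - 2 * (y s - y (j c)))]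
    have h5 := hj c
    simp only [hv] at h5
    linarith
  have hgain : h c t ≤ h c s - δ / 5 := by
    refine csSup_le ⟨_, t, ⟨ht, le_rfl⟩, rfl⟩ ?_
    rintro _ ⟨j, hj, rfl⟩
    have := le_csSup (hbdd c s) ⟨s, ⟨hs, le_rfl⟩, rfl⟩
    linarith [hc j hj.1 hj.2]
  have hsum : h c s - h c t ≤ ∑ c, (h c s - h c t) :=
    Finset.single_le_sum (f := fun c => h c s - h c t)
      (fun c _ => sub_nonneg.2 (hanti c hst)) (Finset.mem_univ c)
  rw [Finset.sum_sub_distrib] at hsum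
  linarith

/-! ### Unfolding the book -/

namespace Book

variable {k : ℕ}

/-- A representative of a point of the book. -/
noncomputable def rep (p : Book k) : PrePoint k := Quotient.out p

/-- The point of the book with given sheet and coordinates. -/
def mk (p : PrePoint k) : Book k := Quotient.mk (bookSetoid k) p

theorem mk_rep (p : Book k) : mk p.rep = p := Quotient.out_eq p

theorem dist_mk (p q : PrePoint k) : dist (mk p) (mk q) = preDist p q := rfl

theorem dist_eq (p q : Book k) : dist p q = preDist p.rep q.rep := by
  rw [← dist_mk, mk_rep, mk_rep]

theorem rep_mk_of_pos (p : PrePoint k) (hp : 0 < p.2.2) : (mk p).rep = p := by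
  have h : bookRel k (mk p).rep p := Quotient.exact (mk_rep (mk p))
  rcases h with h | ⟨_, _, h⟩
  · exact h
  · exact absurd h hp.ne'

/-- The coordinate across the binding after unfolding: positive in the sheet `i` and negative in all
other sheets. -/
noncomputable def height (i : Fin k) (p : Book k) : ℝ :=
  if p.rep.1 = i then p.rep.2.2 else -(p.rep.2.2 : ℝ)

/-- Folding sheets together can only shorten distances. -/
theorem abs_height_sub_le (i : Fin k) (p q : Book k) :
    |height i p - height i q| ≤ |spiderGap p.rep q.rep| := by
  have hp := p.rep.2.2.coe_nonneg
  have hq := q.rep.2.2.coe_nonneg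
  rw [← sq_le_sq]
  unfold height spiderGap
  split_ifs with h1 h2 h3 h4 h5 h6
  all_goals first
    | (exfalso; simp_all; done)
    | nlinarith

/-- With at most one sheet on the folded side nothing overlaps, so planar results apply to pairs of
sheets. -/
theorem sq_height_sub {i j : Fin k} (p q : Book k) (hp : p.rep.1 = i ∨ p.rep.1 = j)
    (hq : q.rep.1 = i ∨ q.rep.1 = j) :
    (height i p - height i q) ^ 2 = spiderGap p.rep q.rep ^ 2 := by
  unfold height spiderGap
  split_ifs with h1 h2 h3 h4 h5 h6
  all_goals first
    | ring1
    | (exfalso; simp_all)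

/-- The unfolding of the book onto the plane that keeps the sheet `i` on one side and folds all other
sheets together on the other side. -/
noncomputable def unfolding (i : Fin k) (p : Book k) : ℝ × ℝ := (p.rep.2.1, height i p)

theorem lipschitzWith_unfolding (i : Fin k) : LipschitzWith 1 (unfolding i) := by
  apply LipschitzWith.of_dist_le_mul
  intro p q
  rw [NNReal.coe_one, one_mul, Prod.dist_eq, Book.dist_eq, preDist]
  refine max_le ?_ ?_
  · rw [Real.dist_eq]
    exact Real.abs_le_sqrt (by simp only [unfolding]; nlinarith [sq_nonneg (spiderGap p.rep q.rep)])
  · rw [Real.dist_eq]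
    refine (abs_height_sub_le i p q).trans (Real.abs_le_sqrt ?_)
    nlinarith [sq_nonneg (p.rep.2.1 - q.rep.2.1)]

/-- The parametrization of the sheet `i` by the plane. -/
noncomputable def sheetMap (i : Fin k) (z : ℝ × ℝ) : Book k := mk (i, z.1, z.2.toNNReal)

/-- The sup metric of `ℝ × ℝ` costs a factor `√2`; the cruder `2` suffices for finiteness. -/
theorem lipschitzWith_sheetMap (i : Fin k) : LipschitzWith 2 (sheetMap i) := by
  apply LipschitzWith.of_dist_le_mul
  intro z w
  rw [sheetMap, sheetMap, dist_mk, preDist]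
  have h1 : |z.1 - w.1| ≤ dist z w := by
    rw [Prod.dist_eq, ← Real.dist_eq]; exact le_max_left _ _
  have h2 : |(z.2.toNNReal : ℝ) - w.2.toNNReal| ≤ dist z w := by
    rw [Prod.dist_eq, Real.coe_toNNReal', Real.coe_toNNReal']
    exact (abs_max_sub_max_le_abs _ _ _).trans (le_max_right _ _)
  simp only [spiderGap, if_true]
  refine Real.sqrt_le_iff.2 ⟨by positivity, ?_⟩
  have h3 := pow_le_pow_left₀ (abs_nonneg _) h1 2
  have h4 := pow_le_pow_left₀ (abs_nonneg _) h2 2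
  rw [sq_abs] at h3 h4
  simp only [NNReal.coe_ofNat]
  nlinarith [sq_nonneg (dist z w)]

theorem sheetMap_unfolding (p : Book k) : sheetMap p.rep.1 (unfolding p.rep.1 p) = p := by
  simp only [sheetMap, unfolding, height, if_true, Real.toNNReal_coe]
  exact mk_rep p

theorem unfolding_sheetMap (i : Fin k) (z : ℝ × ℝ) (hz : 0 < z.2) :
    unfolding i (sheetMap i z) = z := by
  have h : (sheetMap i z).rep = (i, z.1, z.2.toNNReal) := rep_mk_of_pos _ (by simpa using hz)
  simp [unfolding, height, h, hz.le]

/-! ### Area bounds -/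

theorem hausdorffMeasure_lt_top_of_isBounded (A : Set (Book k)) (hA : Bornology.IsBounded A) :
    Measure.hausdorffMeasure 2 A < ∞ := by
  have hsub : A ⊆ ⋃ i : Fin k, sheetMap i '' (unfolding i '' A) := fun p hp =>
    mem_iUnion.2 ⟨p.rep.1, _, ⟨p, hp, rfl⟩, sheetMap_unfolding p⟩
  refine (measure_mono hsub).trans_lt ((measure_iUnion_le _).trans_lt ?_)
  rw [tsum_fintype]
  refine ENNReal.sum_lt_top.2 fun i _ => ?_
  refine ((lipschitzWith_sheetMap i).hausdorffMeasure_image_le (by norm_num) _).trans_lt ?_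
  rw [hausdorffMeasure_prod_real]
  exact ENNReal.mul_lt_top (by simp)
    ((lipschitzWith_unfolding i).isBounded_image hA).measure_lt_top

/-- A set that meets a number of sheets has a neighborhood whose measure is at least proportional to
that number. -/
theorem card_le_hausdorffMeasure_thickening (A : Set (Book k)) (V : Finset (Fin k))
    (hV : ∀ i ∈ V, ∃ p ∈ A, p.rep.1 = i) :
    (V.card : ℝ≥0∞) * ENNReal.ofReal (49 / 50) ≤
      Measure.hausdorffMeasure 2 (Metric.thickening 1 A) := by
  have hV' : ∀ i, ∃ p : Book k, i ∈ V → p ∈ A ∧ p.rep.1 = i := fun i => by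
    by_cases hi : i ∈ V
    · obtain ⟨p, hp⟩ := hV i hi
      exact ⟨p, fun _ => hp⟩
    · exact ⟨sheetMap i 0, fun h => absurd h hi⟩
  choose p hp using hV'
  -- Within distance `7 / 10 * √2 < 1` of `p i`, and strictly off the binding, so that different
  -- sheets give disjoint sets.
  set B : Fin k → Set (ℝ × ℝ) := fun i =>
    Ioo ((p i).rep.2.1 - 7 / 10) ((p i).rep.2.1 + 7 / 10) ×ˢ
      Ioo ((p i).rep.2.2 : ℝ) ((p i).rep.2.2 + 7 / 10) with hB
  have hpos : ∀ i, ∀ z ∈ B i, 0 < z.2 := fun i z hz =>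
    (p i).rep.2.2.coe_nonneg.trans_lt hz.2.1
  have hBvol : ∀ i, volume (B i) = ENNReal.ofReal (49 / 50) := by
    intro i
    rw [hB, Measure.volume_eq_prod, Measure.prod_prod, Real.volume_Ioo, Real.volume_Ioo,
      ← ENNReal.ofReal_mul (by linarith)]
    congr 1
    ring
  set R : Fin k → Set (Book k) := fun i => unfolding i ⁻¹' B i with hR
  have hsheet : ∀ i, ∀ q ∈ R i, q.rep.1 = i := by
    intro i q hq
    by_contra hne
    have h := hpos i _ hq
    simp only [unfolding, height, if_neg hne] at h
    linarith [q.rep.2.2.coe_nonneg]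
  have hmeas : ∀ i, MeasurableSet (R i) := fun i =>
    ((isOpen_Ioo.prod isOpen_Ioo).preimage (lipschitzWith_unfolding i).continuous).measurableSet
  have hRle : ∀ i, ENNReal.ofReal (49 / 50) ≤ Measure.hausdorffMeasure 2 (R i) := by
    intro i
    -- For the sup metric on `ℝ × ℝ`, `μH[2]` is exactly Lebesgue measure.
    have h := (lipschitzWith_unfolding i).hausdorffMeasure_image_le (d := 2) (by norm_num) (R i)
    rw [hausdorffMeasure_prod_real, ENNReal.coe_one, ENNReal.one_rpow, one_mul] at h
    refine le_trans ?_ h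
    rw [← hBvol i]
    refine measure_mono fun z hz => ?_
    have hz' := unfolding_sheetMap i z (hpos i z hz)
    exact ⟨sheetMap i z, by rw [hR, mem_preimage, hz']; exact hz, hz'⟩
  have hsub : ⋃ i ∈ V, R i ⊆ Metric.thickening 1 A := by
    intro q hq
    obtain ⟨i, hi, hq⟩ := mem_iUnion₂.1 hq
    refine Metric.mem_thickening_iff.2 ⟨p i, (hp i hi).1, ?_⟩
    have hqi := hsheet i q hq
    obtain ⟨⟨h1, h2⟩, h3, h4⟩ := hq
    simp only [unfolding, height, if_pos hqi] at h1 h2 h3 h4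
    rw [Book.dist_eq, preDist, spiderGap, if_pos (hqi.trans (hp i hi).2.symm), Real.sqrt_lt' one_pos]
    nlinarith
  calc (V.card : ℝ≥0∞) * ENNReal.ofReal (49 / 50)
      = ∑ _i ∈ V, ENNReal.ofReal (49 / 50) := by rw [Finset.sum_const, nsmul_eq_mul]
    _ ≤ ∑ i ∈ V, Measure.hausdorffMeasure 2 (R i) := Finset.sum_le_sum fun i _ => hRle i
    _ = Measure.hausdorffMeasure 2 (⋃ i ∈ V, R i) := by
        refine (measure_biUnion_finset ?_ fun i _ => hmeas i).symm
        intro i _ j _ hij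
        exact Set.disjoint_left.2 fun q hq hq' => hij ((hsheet i q hq).symm.trans (hsheet j q hq'))
    _ ≤ _ := measure_mono hsub

/-! ### Length bound and conclusion -/

/-- The length of a self-contracted curve in a book is bounded by the diameter of its image and the
number of sheets it meets. -/
theorem eVariationOn_le_of_selfContracted {α : Type*} [LinearOrder α] (f : α → Book k) (D : ℝ)
    (hsc : ∀ s t j, s ≤ t → t ≤ j → dist (f t) (f j) ≤ dist (f s) (f j))
    (hD0 : 0 ≤ D) (hD : ∀ s t, dist (f s) (f t) ≤ D) (V : Finset (Fin k))
    (hV : ∀ t, (f t).rep.1 ∈ V) :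
    eVariationOn f univ ≤ ENNReal.ofReal (120 * (V.card : ℝ) ^ 2 * D) := by
  have hdist : ∀ (i j : Fin k) (s t : α), ((f s).rep.1 = i ∨ (f s).rep.1 = j) →
      ((f t).rep.1 = i ∨ (f t).rep.1 = j) → dist (f s) (f t) =
        √(((f s).rep.2.1 - (f t).rep.2.1) ^ 2 + (height i (f s) - height i (f t)) ^ 2) := by
    intro i j s t hs ht
    rw [Book.dist_eq, preDist, sq_height_sub _ _ hs ht]
  have hpot : ∀ ij : Fin k × Fin k, ∃ G : α → ℝ, Antitone G ∧ (∀ t, 0 ≤ G t) ∧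
      (∀ t, G t ≤ 24 * D) ∧ ∀ s t, s ≤ t → ((f s).rep.1 = ij.1 ∨ (f s).rep.1 = ij.2) →
        ((f t).rep.1 = ij.1 ∨ (f t).rep.1 = ij.2) → dist (f s) (f t) ≤ 5 * (G s - G t) := by
    rintro ⟨i, j⟩
    obtain ⟨G, h1, h2, h3, h4⟩ := exists_potential_of_planar
      {t | (f t).rep.1 = i ∨ (f t).rep.1 = j} (fun t => (f t).rep.2.1) (fun t => height i (f t)) D
      (by
        intro s hs t ht l hl hst htl
        have h := hsc s t l hst htl
        rwa [hdist i j t l ht hl, hdist i j s l hs hl,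
          Real.sqrt_le_sqrt_iff (by positivity)] at h)
      hD0 (fun s hs t ht => by rw [← hdist i j s t hs ht]; exact hD s t)
    exact ⟨G, h1, h2, h3, fun s t hst hs ht => by
      rw [hdist i j s t hs ht]; exact h4 s hs t ht hst⟩
  choose G hanti h0 h24 hG using hpot
  set P : α → ℝ := fun t => ∑ ij ∈ V ×ˢ V, G ij t with hP
  have hstep : ∀ s t, s ≤ t → dist (f s) (f t) ≤ 5 * (P s - P t) := by
    intro s t hst
    refine (hG ((f s).rep.1, (f t).rep.1) s t hst (Or.inl rfl) (Or.inr rfl)).trans ?_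
    rw [hP, ← Finset.sum_sub_distrib]
    refine mul_le_mul_of_nonneg_left ?_ (by norm_num)
    exact Finset.single_le_sum (f := fun ij => G ij s - G ij t)
      (fun ij _ => sub_nonneg.2 (hanti ij hst)) (Finset.mk_mem_product (hV s) (hV t))
  have hP0 : ∀ t, 0 ≤ P t := fun t => Finset.sum_nonneg fun ij _ => h0 ij t
  have hPle : ∀ t, P t ≤ (V.card : ℝ) ^ 2 * (24 * D) := by
    intro t
    refine (Finset.sum_le_card_nsmul _ _ _ fun ij _ => h24 ij t).trans_eq ?_
    rw [Finset.card_product, nsmul_eq_mul]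
    push_cast
    ring
  refine iSup_le ?_
  rintro ⟨n, u, hu, _⟩
  have hsum : ∑ i ∈ Finset.range n, edist (f (u (i + 1))) (f (u i)) ≤
      ∑ i ∈ Finset.range n, ENNReal.ofReal (5 * (P (u i) - P (u (i + 1)))) := by
    refine Finset.sum_le_sum fun i _ => ?_
    rw [edist_comm, edist_dist]
    exact ENNReal.ofReal_le_ofReal (hstep _ _ (hu i.le_succ))
  refine hsum.trans ?_
  rw [← ENNReal.ofReal_sum_of_nonneg fun i _ => dist_nonneg.trans (hstep _ _ (hu i.le_succ)),
    ← Finset.mul_sum, Finset.sum_range_sub' fun i => P (u i)]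
  exact ENNReal.ofReal_le_ofReal (by linarith [hP0 (u n), hPle (u 0)])

end Book

theorem proposition6p2 (k : ℕ) (hk : 1 ≤ k) (ℓ : ℝ≥0∞) (hℓ : 0 < ℓ) (ξ : HalfOpen ℓ → Book k)
    (hsc : SelfContracted ξ) (hbd : Bornology.IsBounded (range ξ)) :
    curveLength ξ ≤ ENNReal.ofReal (54 * √2 * Real.pi) * (k : ℝ≥0∞) *
        hausdorffTwo (Book k) (Metric.thickening 1 (range ξ)) *
        ENNReal.ofReal (Metric.diam (range ξ)) ∧
      ENNReal.ofReal (54 * √2 * Real.pi) * (k : ℝ≥0∞) *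
        hausdorffTwo (Book k) (Metric.thickening 1 (range ξ)) *
        ENNReal.ofReal (Metric.diam (range ξ)) < ∞ := by
  classical
  have hfin := Book.hausdorffMeasure_lt_top_of_isBounded _ (hbd.thickening (δ := 1))
  constructor
  · set V : Finset (Fin k) := Finset.univ.filter fun i => ∃ p ∈ range ξ, p.rep.1 = i
    have hlen := Book.eVariationOn_le_of_selfContracted ξ (Metric.diam (range ξ)) hsc
      Metric.diam_nonneg
      (fun s t => Metric.dist_le_diam_of_mem hbd (mem_range_self s) (mem_range_self t)) V
      (fun t => Finset.mem_filter.2 ⟨Finset.mem_univ _, _, mem_range_self t, rfl⟩)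
    have hlow := Book.card_le_hausdorffMeasure_thickening (range ξ) V fun i hi =>
      (Finset.mem_filter.1 hi).2
    have hVk : V.card ≤ k := by simpa using V.card_le_univ
    refine hlen.trans ?_
    rw [hausdorffTwo, Measure.smul_apply, smul_eq_mul]
    calc ENNReal.ofReal (120 * (V.card : ℝ) ^ 2 * Metric.diam (range ξ))
        ≤ ENNReal.ofReal ((54 * √2 * Real.pi) * k * (Real.pi / 4 * (V.card * (49 / 50))) *
            Metric.diam (range ξ)) := by
          refine ENNReal.ofReal_le_ofReal
            (mul_le_mul_of_nonneg_right ?_ Metric.diam_nonneg)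
          have hc : (V.card : ℝ) ≤ k := by exact_mod_cast hVk
          have h2 : 1.4 ≤ √2 := Real.le_sqrt_of_sq_le (by norm_num)
          have hpi := Real.pi_gt_three
          -- `√2 ≥ 1.4` and `π² ≥ 9` already make the right side exceed 166.
          have hconst : 120 ≤ 54 * √2 * Real.pi * (Real.pi / 4 * (49 / 50)) := by
            have : 9 ≤ Real.pi * Real.pi := by nlinarith
            nlinarith [mul_le_mul h2 this (by norm_num) (Real.sqrt_nonneg 2)]
          have hcc : (V.card : ℝ) ^ 2 ≤ k * V.card := by
            rw [sq]; exact mul_le_mul_of_nonneg_right hc (Nat.cast_nonneg _)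
          calc 120 * (V.card : ℝ) ^ 2
              ≤ (54 * √2 * Real.pi * (Real.pi / 4 * (49 / 50))) * (k * V.card) :=
                mul_le_mul hconst hcc (by positivity) (by positivity)
            _ = _ := by ring
      _ = ENNReal.ofReal (54 * √2 * Real.pi) * (k : ℝ≥0∞) *
            (ENNReal.ofReal (Real.pi / 4) * ((V.card : ℝ≥0∞) * ENNReal.ofReal (49 / 50))) *
            ENNReal.ofReal (Metric.diam (range ξ)) := by
          rw [ENNReal.ofReal_mul (by positivity), ENNReal.ofReal_mul (by positivity),
            ENNReal.ofReal_mul (by positivity), ENNReal.ofReal_natCast,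
            ENNReal.ofReal_mul (p := Real.pi / 4) (by positivity),
            ENNReal.ofReal_mul (p := (V.card : ℝ)) (by positivity), ENNReal.ofReal_natCast]
      _ ≤ _ := by gcongr
  · rw [hausdorffTwo, Measure.smul_apply, smul_eq_mul]
    exact ENNReal.mul_lt_top (ENNReal.mul_lt_top (ENNReal.mul_lt_top ENNReal.ofReal_lt_top
      (ENNReal.natCast_lt_top k)) (ENNReal.mul_lt_top ENNReal.ofReal_lt_top hfin))
      ENNReal.ofReal_lt_top
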